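/- Let $S$ be a finite set of points in $\mathbf{R}^d$ ($d\ge 0$) that is not contained in a hyperplane (its affine hull is $\mathbf{R}^d$) and is generic, in the sense that no $d+2$ points of $S$ lie on a common sphere. A triangulation of $S$ is a simplicial complex in $\mathbf{R}^d$ whose vertex set is $S$ and whose simplices cover exactly the convex hull of $S$. The Voronoi cell of $p\in S$ is $V_p=\{x\in\mathbf{R}^d : \|x-p\|\le\|x-q\| \text{ for all } q\in S\}$, and the Delaunay triangulation $DT(S)$ is the straight-line dual of the Voronoi diagram: a nonempty set $F\subseteq S$ is the vertex set of a simplex of $DT(S)$ if and only if $\bigcap_{p\in F}V_p\neq\emptyset$. For a triangulation $t$ of $S$ put $$C2(t)=\sum_i \|c(\Delta_i)\|^2\,\mathrm{vol}(\Delta_i),$$ where $\Delta_i$ runs over the $d$-simplices of $t$, $c(\Delta_i)$ is the barycenter of $\Delta_i$ (the arithmetic mean of its $d+1$ vertices), $\|\cdot\|$ is the Euclidean norm and $\mathrm{vol}$ is $d$-dimensional volume. Then $DT(S)$ exists and is a triangulation of $S$, and a triangulation $t$ of $S$ maximizes $C2$ among all triangulations of $S$ if and only if $t=DT(S)$. 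-/

import Mathlib

open MeasureTheory Geometry

noncomputable section

namespace PointSet

/-- `d`-dimensional Euclidean space. -/
abbrev Space (d : ℕ) : Type := EuclideanSpace ℝ (Fin d)

variable {d : ℕ}

/-- `S` is generic: no `d + 2` of its points lie on a common sphere of `ℝᵈ`. -/
def IsGeneric (S : Finset (Space d)) : Prop :=
  ∀ T : Finset (Space d), T ⊆ S → T.card = d + 2 →
    ¬ EuclideanGeometry.Cospherical (T : Set (Space d))

/-- `t` is a triangulation of `S`: a (geometric) simplicial complex whose set of vertices is `S`
and whose simplices cover exactly the convex hull of `S`. -/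
structure IsTriangulation (S : Finset (Space d)) (t : SimplicialComplex ℝ (Space d)) : Prop where
  vertices_eq : t.vertices = (S : Set (Space d))
  space_eq : t.space = convexHull ℝ (S : Set (Space d))

/-- The Voronoi cell of `p` with respect to `S`: the points that are at least as close to `p` as to
every point of `S`. -/
def voronoiCell (S : Finset (Space d)) (p : Space d) : Set (Space d) :=
  {x | ∀ q ∈ S, dist x p ≤ dist x q}

/-- `t` is the Delaunay triangulation of `S`, the straight-line dual of the Voronoi diagram: a
nonempty set of points of `S` spans a simplex of `t` if and only if the Voronoi cells of these
points have a common point. (This determines `t`, as it determines the set of its faces.) -/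
def IsDelaunay (S : Finset (Space d)) (t : SimplicialComplex ℝ (Space d)) : Prop :=
  ∀ F : Finset (Space d), F ∈ t.faces ↔
    F.Nonempty ∧ F ⊆ S ∧ (⋂ p ∈ F, voronoiCell S p).Nonempty

/-- The barycenter of the `d`-simplex with the vertex set `F` (of `d + 1` points). -/
def barycenter (F : Finset (Space d)) : Space d :=
  ((d : ℝ) + 1)⁻¹ • ∑ x ∈ F, x

/-- The volume (Lebesgue measure) of the simplex with the vertex set `F`. -/
def simplexVolume (F : Finset (Space d)) : ℝ :=
  (volume (convexHull ℝ (F : Set (Space d)))).toReal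

open Classical in
/-- The vertex sets of the `d`-simplices of a complex `t` with vertices in `S`. -/
def topSimplices (S : Finset (Space d)) (t : SimplicialComplex ℝ (Space d)) :
    Finset (Finset (Space d)) :=
  (S.powersetCard (d + 1)).filter (fun F => F ∈ t.faces)

/-- The parabolic functional `C2(t) = ∑ᵢ ‖c(Δᵢ)‖² vol(Δᵢ)`, the sum over the `d`-simplices `Δᵢ` of
the triangulation `t` of `S`. -/
def C2 (S : Finset (Space d)) (t : SimplicialComplex ℝ (Space d)) : ℝ :=
  ∑ F ∈ topSimplices S t, ‖barycenter F‖ ^ 2 * simplexVolume F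

end PointSet

end

/-!
The idea is to lift the points to the paraboloid, `p ↦ (p, ‖p‖²)`. For a triangulation `t` of `S`
let `L` be the continuous function on the convex hull of `S` that is affine on each simplex of `t`
and equal to `‖p‖²` at each vertex `p`.

On one simplex `Δ` with vertices `pᵢ`, both the integral of `L - ‖x‖²` over `Δ` and its value at
the barycenter are multiples of `∑ ‖pᵢ - pⱼ‖²`, since `L - ‖x‖² = ½ ∑ λᵢ λⱼ ‖pᵢ - pⱼ‖²` in
barycentric coordinates `λ` and since, by affine invariance and symmetry, the mean of `λᵢ λⱼ` over
`Δ` is the same constant `β` for all `i ≠ j` and all simplices. Hence `‖c(Δ)‖² vol(Δ)` is a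
combination `K ∫ ‖x‖² - (K - 1) ∫ L` of integrals over `Δ`, where `K > 1` because `0 < β < 1 / (d +
1)²` (`exists_norm_barycenter_sq_mul_volume`). As the full-dimensional simplices of `t` cover the
convex hull and overlap in null sets, `C2 t` is a constant minus a positive multiple of the
integral of `L` (`exists_C2_eq`), and maximizing `C2` means minimizing this integral.

The simplices of the Delaunay triangulation are the projections of the faces of the lower convex
hull of the lifts: a sphere with center `x` is empty if and only if a certain hyperplane of slope
`2x` passes below all lifts. So the interpolant of the Delaunay triangulation lies below all others
(`sum_mul_norm_sq_le`). If the integrals agree, the interpolants agree almost everywhere, which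
forces each full-dimensional simplex of `t` to be a Delaunay simplex (`paraboloidChord_le`). Then
the two triangulations are equal, as every face of a triangulation is contained in a
full-dimensional one (`IsTriangulation.eq_of_topSimplices_subset`).

The Delaunay complex is a triangulation for these reasons. By genericity the points of `S` nearest
to `x` are affinely independent: the empty sphere can be moved, always keeping these points on it,
until the points of `S` on it span the space, and then there are only `d + 1` of them
(`affineIndependent_nearest`). Two simplices meet in a common face by the equality case of
`sum_mul_norm_sq_le`. They cover the convex hull because over an interior point `y` of the hull
there is a highest hyperplane below the lifts, and `y` is in the convex hull of the points at which
it touches (`mem_convexHull_nearest_of_isMax`).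
-/

noncomputable section

namespace PointSet

/-! ### Empty spheres -/

section EmptySpheres

variable {d : ℕ}

open Classical in
/-- The points of `S` nearest to `x`, that is, the points of `S` on the largest sphere around `x`
that has no point of `S` in its interior. -/
def nearest (S : Finset (Space d)) (x : Space d) : Finset (Space d) :=
  S.filter fun p => ∀ q ∈ S, dist x p ≤ dist x q

theorem mem_nearest {S : Finset (Space d)} {x p : Space d} :
    p ∈ nearest S x ↔ p ∈ S ∧ ∀ q ∈ S, dist x p ≤ dist x q := by
  simp [nearest]

theorem nearest_subset (S : Finset (Space d)) (x : Space d) : nearest S x ⊆ S :=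
  fun _ hp => (mem_nearest.1 hp).1

theorem nonempty_of_span_top {S : Finset (Space d)}
    (hspan : affineSpan ℝ (S : Set (Space d)) = ⊤) : S.Nonempty := by
  rw [← Finset.coe_nonempty, ← affineSpan_nonempty ℝ, hspan]
  exact ⟨0, trivial⟩

theorem nearest_nonempty {S : Finset (Space d)} (hS : S.Nonempty) (x : Space d) :
    (nearest S x).Nonempty := by
  obtain ⟨p, hp, h⟩ := S.exists_min_image (dist x) hS
  exact ⟨p, mem_nearest.2 ⟨hp, h⟩⟩

theorem dist_eq_of_mem_nearest {S : Finset (Space d)} {x p q : Space d} (hp : p ∈ nearest S x)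
    (hq : q ∈ nearest S x) : dist x p = dist x q :=
  le_antisymm ((mem_nearest.1 hp).2 _ (mem_nearest.1 hq).1)
    ((mem_nearest.1 hq).2 _ (mem_nearest.1 hp).1)

theorem iInter_voronoiCell_nonempty_iff {S F : Finset (Space d)} :
    (F ⊆ S ∧ (⋂ p ∈ F, voronoiCell S p).Nonempty) ↔ ∃ x, F ⊆ nearest S x := by
  constructor
  · rintro ⟨hFS, x, hx⟩
    exact ⟨x, fun p hp => mem_nearest.2 ⟨hFS hp, Set.mem_iInter₂.1 hx p hp⟩⟩
  · rintro ⟨x, hx⟩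
    exact ⟨hx.trans (nearest_subset S x), x,
      Set.mem_iInter₂.2 fun p hp => (mem_nearest.1 (hx hp)).2⟩

theorem dist_sq_eq (x q : Space d) : dist x q ^ 2 = ‖x‖ ^ 2 - 2 * inner ℝ x q + ‖q‖ ^ 2 := by
  rw [dist_eq_norm, norm_sub_sq_real]

theorem sum_mul_dist_sq {F : Finset (Space d)} {w : Space d → ℝ} {y : Space d}
    (hw1 : ∑ p ∈ F, w p = 1) (hwy : ∑ p ∈ F, w p • p = y) (x : Space d) :
    ∑ p ∈ F, w p * dist x p ^ 2 =
      ‖x‖ ^ 2 - 2 * inner ℝ x y + ∑ p ∈ F, w p * ‖p‖ ^ 2 := by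
  have h : ∀ p ∈ F, w p * dist x p ^ 2 =
      w p * ‖x‖ ^ 2 - 2 * inner ℝ x (w p • p) + w p * ‖p‖ ^ 2 := by
    intro p _
    rw [dist_sq_eq, inner_smul_right]
    ring
  rw [Finset.sum_congr rfl h, Finset.sum_add_distrib, Finset.sum_sub_distrib, ← Finset.sum_mul,
    hw1, ← Finset.mul_sum, ← inner_sum, hwy, one_mul]

/-- The nearest points of `x` span a face of the lower convex hull of the lifts `(p, ‖p‖²)`:
among the ways to write `y` as a convex combination of points of `S`, one that uses only points
nearest to `x` has the smallest mean of `‖p‖²`. -/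
theorem sum_mul_norm_sq_le {S F G : Finset (Space d)} {x y : Space d} {w v : Space d → ℝ}
    (hF : F ⊆ nearest S x) (hw1 : ∑ p ∈ F, w p = 1) (hwy : ∑ p ∈ F, w p • p = y)
    (hG : G ⊆ S) (hv0 : ∀ q ∈ G, 0 ≤ v q) (hv1 : ∑ q ∈ G, v q = 1)
    (hvy : ∑ q ∈ G, v q • q = y) :
    ∑ p ∈ F, w p * ‖p‖ ^ 2 ≤ ∑ q ∈ G, v q * ‖q‖ ^ 2 ∧
      (∑ p ∈ F, w p * ‖p‖ ^ 2 = ∑ q ∈ G, v q * ‖q‖ ^ 2 →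
        ∀ q ∈ G, v q ≠ 0 → q ∈ nearest S x) := by
  obtain ⟨p₀, hp₀⟩ : F.Nonempty := by
    rw [Finset.nonempty_iff_ne_empty]
    rintro rfl
    simp at hw1
  have hmin : ∀ q ∈ S, dist x p₀ ≤ dist x q := (mem_nearest.1 (hF hp₀)).2
  have hFs : ∑ p ∈ F, w p * dist x p ^ 2 = dist x p₀ ^ 2 := by
    rw [Finset.sum_congr rfl fun p hp => by
      rw [dist_eq_of_mem_nearest (hF hp) (hF hp₀)], ← Finset.sum_mul, hw1, one_mul]
  have hterm : ∀ q ∈ G, 0 ≤ v q * (dist x q ^ 2 - dist x p₀ ^ 2) := fun q hq =>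
    mul_nonneg (hv0 q hq) (sub_nonneg.2 (pow_le_pow_left₀ dist_nonneg (hmin q (hG hq)) 2))
  have hGs : ∑ q ∈ G, v q * (dist x q ^ 2 - dist x p₀ ^ 2) =
      ∑ q ∈ G, v q * dist x q ^ 2 - dist x p₀ ^ 2 := by
    simp only [mul_sub, Finset.sum_sub_distrib, ← Finset.sum_mul, hv1, one_mul]
  have h1 := sum_mul_dist_sq hw1 hwy x
  have h2 := sum_mul_dist_sq hv1 hvy x
  refine ⟨by linarith [Finset.sum_nonneg hterm], fun heq q hq hvq => ?_⟩
  have h0 : ∑ q ∈ G, v q * (dist x q ^ 2 - dist x p₀ ^ 2) = 0 := by linarith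
  have hq0 := (Finset.sum_eq_zero_iff_of_nonneg hterm).1 h0 q hq
  have hd : dist x q = dist x p₀ := by
    have := (mul_eq_zero.1 hq0).resolve_left hvq
    exact (pow_left_inj₀ dist_nonneg dist_nonneg two_ne_zero).1 (by linarith)
  exact mem_nearest.2 ⟨hG hq, fun q' hq' => hd.le.trans (hmin q' hq')⟩

/-- If the nearest points of `x` do not affinely span the space, the centre can be moved at right
angles to their affine span until the empty sphere around it hits a further point of `S`. -/
theorem exists_nearest_ssubset {S : Finset (Space d)}
    (hspan : affineSpan ℝ (S : Set (Space d)) = ⊤) (x : Space d)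
    (hx : affineSpan ℝ (nearest S x : Set (Space d)) ≠ ⊤) :
    ∃ x', nearest S x ⊂ nearest S x' := by
  obtain ⟨p, hp⟩ := nearest_nonempty (nonempty_of_span_top hspan) x
  set A := affineSpan ℝ (nearest S x : Set (Space d)) with hA
  have hpA : p ∈ A := subset_affineSpan ℝ _ hp
  obtain ⟨q, hqS, hqA⟩ : ∃ q ∈ S, q ∉ A := by
    by_contra! h
    exact hx (top_le_iff.1 (hspan ▸ affineSpan_le.2 h))
  -- `u` is the part of `q - p` orthogonal to the affine span of the nearest points.
  obtain ⟨u, hu, huq⟩ : ∃ u ∈ A.directionᗮ, 0 < inner ℝ u (q - p) := by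
    obtain ⟨a, ha, u, hu, hau⟩ := A.direction.exists_add_mem_mem_orthogonal (q - p)
    refine ⟨u, hu, ?_⟩
    have hu0 : u ≠ 0 := by
      rintro rfl
      apply hqA
      have := AffineSubspace.vadd_mem_of_mem_direction ha hpA
      rw [add_zero] at hau
      rwa [vadd_eq_add, ← hau, sub_add_cancel] at this
    rw [hau, inner_add_right, real_inner_comm, hu a ha, zero_add]
    exact real_inner_self_pos.2 hu0
  have hunear : ∀ p' ∈ nearest S x, inner ℝ u (p' - p) = 0 := fun p' hp' => by
    rw [real_inner_comm]
    exact hu _ (AffineSubspace.vsub_mem_direction (subset_affineSpan ℝ _ hp') hpA)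
  let gap : Space d → ℝ := fun q => dist x q ^ 2 - dist x p ^ 2
  have hgap0 : ∀ q ∈ S, 0 ≤ gap q := fun q hq =>
    sub_nonneg.2 (pow_le_pow_left₀ dist_nonneg ((mem_nearest.1 hp).2 q hq) 2)
  -- `s` is the largest step in direction `u` for which the sphere through `p` stays empty.
  obtain ⟨q₀, hq₀, hmin⟩ := (S.filter fun q => 0 < inner ℝ u (q - p)).exists_min_image
    (fun q => gap q / (2 * inner ℝ u (q - p))) ⟨q, Finset.mem_filter.2 ⟨hqS, huq⟩⟩
  obtain ⟨hq₀S, hq₀u⟩ := Finset.mem_filter.1 hq₀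
  set s := gap q₀ / (2 * inner ℝ u (q₀ - p)) with hs
  have hs0 : 0 ≤ s := div_nonneg (hgap0 q₀ hq₀S) (by positivity)
  have hmove : ∀ q, dist (x + s • u) q ^ 2 - dist (x + s • u) p ^ 2 =
      gap q - s * (2 * inner ℝ u (q - p)) := by
    intro q
    simp only [gap, dist_sq_eq, inner_add_left, inner_smul_left, inner_sub_right]
    simp only [conj_trivial]
    ring
  have hempty : ∀ q ∈ S, dist (x + s • u) p ≤ dist (x + s • u) q := by
    intro q hq
    rw [← pow_le_pow_iff_left₀ dist_nonneg dist_nonneg two_ne_zero, ← sub_nonneg, hmove]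
    rcases le_or_gt (inner ℝ u (q - p)) 0 with h | h
    · have := mul_nonneg hs0 (by linarith : 0 ≤ -(2 * inner ℝ u (q - p)))
      linarith [hgap0 q hq]
    · have := hmin q (Finset.mem_filter.2 ⟨hq, h⟩)
      rw [le_div_iff₀ (by positivity)] at this
      linarith
  have htight : ∀ q ∈ S, gap q - s * (2 * inner ℝ u (q - p)) = 0 → q ∈ nearest S (x + s • u) := by
    intro q hq h
    rw [← hmove, sub_eq_zero, pow_left_inj₀ dist_nonneg dist_nonneg two_ne_zero] at h
    exact mem_nearest.2 ⟨hq, fun q' hq' => h.le.trans (hempty q' hq')⟩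
  refine ⟨x + s • u, Finset.ssubset_iff_subset_ne.2 ⟨fun p' hp' => ?_, fun h => ?_⟩⟩
  · refine htight p' (nearest_subset S x hp') ?_
    simp [hunear p' hp', gap, dist_eq_of_mem_nearest hp' hp]
  · have : q₀ ∈ nearest S x := by
      rw [h]
      refine htight q₀ hq₀S ?_
      rw [hs, div_mul_cancel₀ _ (by positivity), sub_self]
    exact hq₀u.ne' (hunear q₀ this)

theorem exists_nearest_subset_span_top {S : Finset (Space d)}
    (hspan : affineSpan ℝ (S : Set (Space d)) = ⊤) (x : Space d) :
    ∃ x', nearest S x ⊆ nearest S x' ∧ affineSpan ℝ (nearest S x' : Set (Space d)) = ⊤ := by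
  induction h : S.card - (nearest S x).card using Nat.strong_induction_on generalizing x with
  | _ n ih =>
    by_cases hx : affineSpan ℝ (nearest S x : Set (Space d)) = ⊤
    · exact ⟨x, subset_rfl, hx⟩
    · obtain ⟨x₁, h₁⟩ := exists_nearest_ssubset hspan x hx
      have hlt := Finset.card_lt_card h₁
      have hle := Finset.card_le_card (nearest_subset S x₁)
      obtain ⟨x₂, h₂, h₃⟩ := ih _ (by omega) x₁ rfl
      exact ⟨x₂, h₁.subset.trans h₂, h₃⟩

theorem card_nearest_le {S : Finset (Space d)} (hgen : IsGeneric S) (x : Space d) :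
    (nearest S x).card ≤ d + 1 := by
  by_contra! h
  obtain ⟨T, hT, hTc⟩ := Finset.exists_subset_card_eq (Nat.succ_le_of_lt h)
  obtain ⟨p, hp⟩ : T.Nonempty := Finset.card_pos.1 (by omega)
  refine hgen T (hT.trans (nearest_subset S x)) hTc ⟨x, dist x p, fun q hq => ?_⟩
  rw [dist_comm, dist_eq_of_mem_nearest (hT hq) (hT hp)]

theorem affineIndependent_of_span_top_of_card_le {T : Finset (Space d)}
    (hspan : affineSpan ℝ (T : Set (Space d)) = ⊤) (hc : T.card ≤ d + 1) :
    AffineIndependent ℝ ((↑) : T → Space d) := by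
  have hv : vectorSpan ℝ (T : Set (Space d)) = ⊤ := by
    rw [← direction_affineSpan, hspan, AffineSubspace.direction_top]
  have hpos := (nonempty_of_span_top hspan).card_pos
  rw [affineIndependent_iff_le_finrank_vectorSpan ℝ _ (n := T.card - 1)
    (by rw [Fintype.card_coe]; omega)]
  have : Set.range ((↑) : T → Space d) = T := by simp
  rw [this, hv, finrank_top, finrank_euclideanSpace_fin]
  omega

/-- Genericity makes every set of nearest points the vertex set of a simplex: it is contained in
such a set that spans the space, and this one has only `d + 1` points. -/
theorem affineIndependent_nearest {S : Finset (Space d)}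
    (hspan : affineSpan ℝ (S : Set (Space d)) = ⊤) (hgen : IsGeneric S) (x : Space d) :
    AffineIndependent ℝ ((↑) : nearest S x → Space d) := by
  obtain ⟨x', h, hx'⟩ := exists_nearest_subset_span_top hspan x
  exact (affineIndependent_of_span_top_of_card_le hx' (card_nearest_le hgen x')).mono
    (Finset.coe_subset.2 h)

end EmptySpheres

/-! ### The Delaunay triangulation -/

section Delaunay

variable {d : ℕ}

theorem isCompact_convexHull_finset (F : Finset (Space d)) :
    IsCompact (convexHull ℝ (F : Set (Space d))) :=
  F.finite_toSet.isCompact_convexHull (𝕜 := ℝ)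

theorem interior_convexHull_nonempty {S : Finset (Space d)}
    (hspan : affineSpan ℝ (S : Set (Space d)) = ⊤) :
    (interior (convexHull ℝ (S : Set (Space d)))).Nonempty :=
  interior_convexHull_nonempty_iff_affineSpan_eq_top.2 hspan

theorem closure_interior_convexHull {S : Finset (Space d)}
    (hspan : affineSpan ℝ (S : Set (Space d)) = ⊤) :
    closure (interior (convexHull ℝ (S : Set (Space d)))) = convexHull ℝ (S : Set (Space d)) := by
  rw [(convex_convexHull ℝ _).closure_interior_eq_closure_of_nonempty_interior
    (interior_convexHull_nonempty hspan), (isCompact_convexHull_finset S).isClosed.closure_eq]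

/-- The height over `y` of the highest hyperplane with slope `2x` below the lifts `(q, ‖q‖²)` of
the points of `S`. -/
def supportHeight (S : Finset (Space d)) (hS : S.Nonempty) (y x : Space d) : ℝ :=
  S.inf' hS fun q => ‖q‖ ^ 2 - 2 * inner ℝ x (q - y)

theorem continuous_supportHeight (S : Finset (Space d)) (hS : S.Nonempty) (y : Space d) :
    Continuous (supportHeight S hS y) :=
  Continuous.finset_inf'_apply hS fun q _ => by fun_prop

/-- Over an interior point of the convex hull, steep hyperplanes below the lifts are very low. -/
theorem tendsto_supportHeight (S : Finset (Space d)) (hS : S.Nonempty) {y : Space d}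
    (hy : y ∈ interior (convexHull ℝ (S : Set (Space d)))) :
    Filter.Tendsto (supportHeight S hS y) (Filter.cocompact _) Filter.atBot := by
  obtain ⟨ε, hε, hball⟩ := Metric.isOpen_iff.1 isOpen_interior y hy
  obtain ⟨M, hM⟩ := (S.finite_toSet.image fun q => ‖q‖ ^ 2).bddAbove
  have hbound : ∀ x, supportHeight S hS y x ≤ M - ε * ‖x‖ := by
    intro x
    -- Some point of `S` lies at least as far in direction `x` as `y + (ε / 2) • x / ‖x‖`.
    have hz : y + (ε / 2 * ‖x‖⁻¹) • x ∈ convexHull ℝ (S : Set (Space d)) := by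
      apply interior_subset
      apply hball
      rw [Metric.mem_ball, dist_self_add_left, norm_smul, Real.norm_of_nonneg (by positivity)]
      by_cases hx : ‖x‖ = 0
      · simpa [hx] using hε
      · rw [mul_assoc, inv_mul_cancel₀ hx]
        linarith
    obtain ⟨w, hw0, hw1, hwz⟩ := Finset.mem_convexHull'.1 hz
    have hsum : ∑ q ∈ S, w q * (inner ℝ x (q - y) - ε / 2 * ‖x‖) = 0 := by
      have h1 : inner ℝ x (∑ q ∈ S, w q • q) = inner ℝ x y + ε / 2 * ‖x‖ := by
        rw [hwz, inner_add_right, inner_smul_right, real_inner_self_eq_norm_sq]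
        by_cases hx : ‖x‖ = 0
        · simp [hx]
        · field_simp
      rw [inner_sum] at h1
      simp only [inner_smul_right] at h1
      simp only [inner_sub_right, mul_sub, Finset.sum_sub_distrib, ← Finset.sum_mul, hw1, h1]
      ring
    obtain ⟨q, hq, hqx⟩ : ∃ q ∈ S, ε / 2 * ‖x‖ ≤ inner ℝ x (q - y) := by
      by_contra! h
      have hle : ∀ q ∈ S, 0 ≤ -(w q * (inner ℝ x (q - y) - ε / 2 * ‖x‖)) := fun q hq => by
        rw [← mul_neg]
        exact mul_nonneg (hw0 q hq) (by linarith [h q hq])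
      have h0 := (Finset.sum_eq_zero_iff_of_nonneg hle).1 (by rw [Finset.sum_neg_distrib, hsum,
        neg_zero])
      have : ∑ q ∈ S, w q = 0 := Finset.sum_eq_zero fun q hq =>
        (mul_eq_zero.1 (neg_eq_zero.1 (h0 q hq))).resolve_right (by linarith [h q hq])
      linarith
    have h1 : supportHeight S hS y x ≤ ‖q‖ ^ 2 - 2 * inner ℝ x (q - y) :=
      Finset.inf'_le (f := fun q => ‖q‖ ^ 2 - 2 * inner ℝ x (q - y)) hq
    have h2 : ‖q‖ ^ 2 ≤ M := hM ⟨q, hq, rfl⟩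
    linarith
  refine Filter.tendsto_atBot_mono hbound ?_
  refine Filter.tendsto_atBot_add_const_left _ M ?_ |>.congr fun x => (sub_eq_add_neg _ _).symm
  exact Filter.tendsto_neg_atTop_atBot.comp
    ((tendsto_norm_cocompact_atTop).const_mul_atTop hε)

/-- If the hyperplane with slope `2x` is the highest one over `y`, then `y` lies in the convex hull
of the points at which it touches: otherwise it could be tilted upwards over `y`. -/
theorem mem_convexHull_nearest_of_isMax (S : Finset (Space d)) (hS : S.Nonempty) {y x : Space d}
    (hx : ∀ x', supportHeight S hS y x' ≤ supportHeight S hS y x) :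
    y ∈ convexHull ℝ (nearest S x : Set (Space d)) := by
  by_contra hy
  obtain ⟨f, u, hfy, hf⟩ := geometric_hahn_banach_point_closed (convex_convexHull ℝ _)
    (isCompact_convexHull_finset (nearest S x)).isClosed hy
  set v := (InnerProductSpace.toDual ℝ (Space d)).symm f
  have hv : ∀ z, inner ℝ v z = f z := fun z => InnerProductSpace.toDual_symm_apply
  have hpos : ∀ q ∈ nearest S x, 0 < inner ℝ v (q - y) := fun q hq => by
    rw [hv, map_sub]
    linarith [hf q (subset_convexHull ℝ _ hq)]
  set m := supportHeight S hS y x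
  have hm : ∀ q ∈ S, m ≤ ‖q‖ ^ 2 - 2 * inner ℝ x (q - y) := fun q hq =>
    Finset.inf'_le (f := fun q => ‖q‖ ^ 2 - 2 * inner ℝ x (q - y)) hq
  have hm' : ∀ q ∈ S, q ∉ nearest S x → m < ‖q‖ ^ 2 - 2 * inner ℝ x (q - y) := by
    intro q hq hqx
    refine lt_of_le_of_ne (hm q hq) fun h => hqx (mem_nearest.2 ⟨hq, fun p hp => ?_⟩)
    have := hm p hp
    rw [h, inner_sub_right, inner_sub_right] at this
    rw [← pow_le_pow_iff_left₀ dist_nonneg dist_nonneg two_ne_zero, dist_sq_eq, dist_sq_eq]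
    linarith
  have hev : ∀ᶠ ε : ℝ in nhdsWithin 0 (Set.Ioi 0), ∀ q ∈ S,
      m < ‖q‖ ^ 2 - 2 * inner ℝ (x - ε • v) (q - y) := by
    rw [Filter.eventually_all_finset]
    intro q hq
    by_cases hqx : q ∈ nearest S x
    · filter_upwards [self_mem_nhdsWithin] with ε hε
      have := mul_pos hε (hpos q hqx)
      rw [inner_sub_left, real_inner_smul_left]
      linarith [hm q hq]
    · have hc : Continuous fun ε : ℝ => ‖q‖ ^ 2 - 2 * inner ℝ (x - ε • v) (q - y) := by fun_prop
      refine nhdsWithin_le_nhds (hc.continuousAt.eventually (lt_mem_nhds ?_))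
      simpa using hm' q hq hqx
  obtain ⟨ε, hε⟩ := hev.exists
  exact absurd (hx (x - ε • v)) (not_le.2 ((Finset.lt_inf'_iff _).2 hε))

theorem exists_mem_convexHull_nearest {S : Finset (Space d)}
    (hspan : affineSpan ℝ (S : Set (Space d)) = ⊤) {y : Space d}
    (hy : y ∈ convexHull ℝ (S : Set (Space d))) :
    ∃ x, y ∈ convexHull ℝ (nearest S x : Set (Space d)) := by
  classical
  have hS := nonempty_of_span_top hspan
  set U : Set (Space d) := ⋃ F ∈ {F ∈ S.powerset | ∃ x, F = nearest S x},
    convexHull ℝ (F : Set (Space d)) with hU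
  have hclosed : IsClosed U :=
    isClosed_biUnion_finset fun F _ => (isCompact_convexHull_finset F).isClosed
  have hint : interior (convexHull ℝ (S : Set (Space d))) ⊆ U := by
    intro z hz
    obtain ⟨x, hx⟩ := (continuous_supportHeight S hS z).exists_forall_ge
      (tendsto_supportHeight S hS hz)
    refine Set.mem_iUnion₂.2 ⟨nearest S x, ?_, mem_convexHull_nearest_of_isMax S hS hx⟩
    exact Finset.mem_filter.2 ⟨Finset.mem_powerset.2 (nearest_subset S x), x, rfl⟩
  have := closure_minimal hint hclosed
  rw [closure_interior_convexHull hspan] at this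
  obtain ⟨F, hF, hyF⟩ := Set.mem_iUnion₂.1 (this hy)
  obtain ⟨x, rfl⟩ := (Finset.mem_filter.1 hF).2
  exact ⟨x, hyF⟩

theorem convexHull_inter_subset_of_nearest {S F G : Finset (Space d)}
    (hspan : affineSpan ℝ (S : Set (Space d)) = ⊤) (hgen : IsGeneric S) {x x' : Space d}
    (hF : F ⊆ nearest S x) (hG : G ⊆ nearest S x') :
    convexHull ℝ (F : Set (Space d)) ∩ convexHull ℝ (G : Set (Space d)) ⊆
      convexHull ℝ ((F : Set (Space d)) ∩ G) := by
  classical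
  rintro y ⟨hyF, hyG⟩
  obtain ⟨w, hw0, hw1, hwy⟩ := Finset.mem_convexHull'.1 hyF
  obtain ⟨v, hv0, hv1, hvy⟩ := Finset.mem_convexHull'.1 hyG
  have h1 := sum_mul_norm_sq_le hF hw1 hwy (hG.trans (nearest_subset _ _)) hv0 hv1 hvy
  have h2 := sum_mul_norm_sq_le hG hv1 hvy (hF.trans (nearest_subset _ _)) hw0 hw1 hwy
  have hsupp := h2.2 (le_antisymm h2.1 h1.1)
  -- The points of `F` with positive weight belong to the affinely independent set around `x'`.
  have hF' : F.filter (fun p => w p ≠ 0) ⊆ nearest S x' := fun p hp =>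
    hsupp p (Finset.mem_filter.1 hp).1 (Finset.mem_filter.1 hp).2
  have hyF' : y ∈ convexHull ℝ (F.filter (fun p => w p ≠ 0) : Set (Space d)) := by
    refine Finset.mem_convexHull'.2 ⟨w, fun p hp => hw0 p (Finset.mem_filter.1 hp).1, ?_, ?_⟩
    · rw [← hw1]
      exact Finset.sum_filter_ne_zero F
    · rw [← hwy]
      refine Finset.sum_filter_of_ne fun p _ hp hwp => hp ?_
      rw [hwp, zero_smul]
  have := (affineIndependent_nearest hspan hgen x').convexHull_inter hF' hG
  refine convexHull_mono (Set.inter_subset_inter_left _ ?_) (this.ge ⟨hyF', hyG⟩)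
  exact Finset.coe_subset.2 (Finset.filter_subset _ _)

/-- The complex of the nonempty sets of points of `S` that lie on a sphere with no point of `S` in
its interior. -/
def delaunayComplex (S : Finset (Space d)) (hspan : affineSpan ℝ (S : Set (Space d)) = ⊤)
    (hgen : IsGeneric S) : SimplicialComplex ℝ (Space d) where
  faces := {F | F.Nonempty ∧ ∃ x, F ⊆ nearest S x}
  isRelLowerSet_faces := by
    rintro F ⟨hF, x, hx⟩
    exact ⟨hF, fun G hG hGne => ⟨hGne, x, hG.trans hx⟩⟩
  indep := by
    rintro F ⟨_, x, hx⟩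
    exact (affineIndependent_nearest hspan hgen x).mono (Finset.coe_subset.2 hx)
  inter_subset_convexHull := by
    rintro F G ⟨_, x, hx⟩ ⟨_, x', hx'⟩
    exact convexHull_inter_subset_of_nearest hspan hgen hx hx'

theorem isDelaunay_iff {S : Finset (Space d)} {t : SimplicialComplex ℝ (Space d)} :
    IsDelaunay S t ↔ ∀ F : Finset (Space d), F ∈ t.faces ↔ F.Nonempty ∧ ∃ x, F ⊆ nearest S x :=
  forall_congr' fun F => by rw [iInter_voronoiCell_nonempty_iff]

theorem isDelaunay_delaunayComplex {S : Finset (Space d)}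
    (hspan : affineSpan ℝ (S : Set (Space d)) = ⊤) (hgen : IsGeneric S) :
    IsDelaunay S (delaunayComplex S hspan hgen) :=
  isDelaunay_iff.2 fun _ => Iff.rfl

theorem isTriangulation_delaunayComplex {S : Finset (Space d)}
    (hspan : affineSpan ℝ (S : Set (Space d)) = ⊤) (hgen : IsGeneric S) :
    IsTriangulation S (delaunayComplex S hspan hgen) where
  vertices_eq := by
    ext p
    constructor
    · rintro ⟨_, x, hx⟩
      exact nearest_subset S x (hx (Finset.mem_singleton_self p))
    · intro hp
      refine ⟨Finset.singleton_nonempty p, p, Finset.singleton_subset_iff.2 ?_⟩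
      exact mem_nearest.2 ⟨hp, fun q _ => by simp⟩
  space_eq := by
    ext y
    rw [SimplicialComplex.mem_space_iff]
    constructor
    · rintro ⟨F, ⟨_, x, hx⟩, hy⟩
      exact convexHull_mono (Finset.coe_subset.2 (hx.trans (nearest_subset S x))) hy
    · intro hy
      obtain ⟨x, hx⟩ := exists_mem_convexHull_nearest hspan hy
      exact ⟨nearest S x, ⟨nearest_nonempty (nonempty_of_span_top hspan) x, x, subset_rfl⟩, hx⟩

end Delaunay

/-! ### Moments of barycentric coordinates on a simplex -/

section Moments

variable {d : ℕ} {ι : Type*}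

/-- The integral over the simplex spanned by `b` of a function of the barycentric coordinates. -/
def simplexIntegral (b : AffineBasis ι ℝ (Space d)) (g : (ι → ℝ) → ℝ) : ℝ :=
  ∫ x in convexHull ℝ (Set.range b), g (b.coords x)

theorem simplexIntegral_one (b : AffineBasis ι ℝ (Space d)) :
    simplexIntegral b (fun _ => 1) = volume.real (convexHull ℝ (Set.range b)) := by
  simp [simplexIntegral]

theorem continuous_coords (b : AffineBasis ι ℝ (Space d)) : Continuous b.coords :=
  continuous_pi fun i => continuous_barycentric_coord b i

theorem simplexIntegral_const_mul (b : AffineBasis ι ℝ (Space d)) (c : ℝ) (g : (ι → ℝ) → ℝ) :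
    simplexIntegral b (fun l => c * g l) = c * simplexIntegral b g :=
  integral_const_mul c _

variable [Fintype ι]

theorem coord_sum_smul (b b' : AffineBasis ι ℝ (Space d)) (x : Space d) (i : ι) :
    b'.coord i (∑ j, b.coord j x • b' j) = b.coord i x := by
  classical
  have h := b'.coord_apply_combination_of_mem (Finset.mem_univ i) (b.sum_coord_apply_eq_one x)
  rwa [Finset.affineCombination_eq_linear_combination _ _ _ (b.sum_coord_apply_eq_one x)] at h

theorem hasFDerivAt_affineMap {E F : Type*} [NormedAddCommGroup E] [NormedSpace ℝ E]
    [FiniteDimensional ℝ E] [NormedAddCommGroup F] [NormedSpace ℝ F] (f : E →ᵃ[ℝ] F) (x : E) :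
    HasFDerivAt f (LinearMap.toContinuousLinearMap f.linear) x := by
  have h : (f : E → F) = fun y => LinearMap.toContinuousLinearMap f.linear y + f 0 := by
    ext y
    simpa using congrFun f.decomp y
  rw [h]
  exact (LinearMap.toContinuousLinearMap f.linear).hasFDerivAt.add_const _

/-- The affine map that takes one affine basis to another multiplies all integrals by the same
factor. -/
theorem exists_simplexIntegral_eq_mul (b b' : AffineBasis ι ℝ (Space d)) :
    ∃ c : ℝ, ∀ g : (ι → ℝ) → ℝ, simplexIntegral b' g = c * simplexIntegral b g := by
  let f : Space d → Space d := fun x => ∑ i, b.coord i x • b' i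
  let f' : Space d →L[ℝ] Space d :=
    ∑ i, (LinearMap.toContinuousLinearMap (b.coord i).linear).smulRight (b' i)
  have hf' : ∀ x, HasFDerivAt f f' x := fun x =>
    HasFDerivAt.fun_sum fun i _ => (hasFDerivAt_affineMap (b.coord i) x).smul_const (b' i)
  have hcoord : ∀ x, b'.coords (f x) = b.coords x := fun x => by
    ext i
    rw [b'.coords_apply, b.coords_apply]
    exact coord_sum_smul b b' x i
  have hinj : Function.Injective f := fun x y hxy => b.ext_elem fun i => by
    have := congrFun (congrArg b'.coords hxy) i
    rwa [hcoord, hcoord] at this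
  have himage : f '' convexHull ℝ (Set.range b) = convexHull ℝ (Set.range b') := by
    rw [b.convexHull_eq_nonneg_coord, b'.convexHull_eq_nonneg_coord]
    ext y
    constructor
    · rintro ⟨x, hx, rfl⟩ i
      rw [coord_sum_smul b b' x i]
      exact hx i
    · intro hy
      refine ⟨∑ i, b'.coord i y • b i, fun i => ?_, b'.ext_elem fun i => ?_⟩
      · rw [coord_sum_smul b' b]
        exact hy i
      · rw [coord_sum_smul b b', coord_sum_smul b' b]
  refine ⟨|f'.det|, fun g => ?_⟩
  have hmeas : MeasurableSet (convexHull ℝ (Set.range b)) :=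
    ((Set.finite_range b).isCompact_convexHull (𝕜 := ℝ)).measurableSet
  rw [simplexIntegral, ← himage, integral_image_eq_integral_abs_det_fderiv_smul volume hmeas
    (fun x _ => (hf' x).hasFDerivWithinAt) hinj.injOn]
  simp only [hcoord, smul_eq_mul]
  rw [integral_const_mul, simplexIntegral]

theorem integrableOn_simplex (b : AffineBasis ι ℝ (Space d)) {g : Space d → ℝ}
    (hg : Continuous g) : IntegrableOn g (convexHull ℝ (Set.range b)) :=
  hg.continuousOn.integrableOn_compact ((Set.finite_range b).isCompact_convexHull (𝕜 := ℝ))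

/-- A continuous function that is nonnegative on a simplex and positive at one of its points has a
positive integral, as the simplex is the closure of its interior. -/
theorem simplexIntegral_pos (b : AffineBasis ι ℝ (Space d)) {g : (ι → ℝ) → ℝ} (hg : Continuous g)
    (h0 : ∀ x ∈ convexHull ℝ (Set.range b), 0 ≤ g (b.coords x)) {x₀ : Space d}
    (hx₀ : x₀ ∈ convexHull ℝ (Set.range b)) (hpos : 0 < g (b.coords x₀)) :
    0 < simplexIntegral b g := by
  have hcomp : IsCompact (convexHull ℝ (Set.range b)) :=
    (Set.finite_range b).isCompact_convexHull (𝕜 := ℝ)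
  have hcont : Continuous fun x => g (b.coords x) := hg.comp (continuous_coords b)
  rw [simplexIntegral, setIntegral_pos_iff_support_of_nonneg_ae
    (ae_restrict_of_forall_mem hcomp.measurableSet h0) (integrableOn_simplex b hcont)]
  have hne : (interior (convexHull ℝ (Set.range b))).Nonempty :=
    interior_convexHull_nonempty_iff_affineSpan_eq_top.2 b.tot
  have hopen : IsOpen {x | 0 < g (b.coords x)} := isOpen_lt continuous_const hcont
  have hcl : x₀ ∈ closure (interior (convexHull ℝ (Set.range b))) := by
    rw [(convex_convexHull ℝ _).closure_interior_eq_closure_of_nonempty_interior hne]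
    exact subset_closure hx₀
  obtain ⟨z, hz1, hz2⟩ := mem_closure_iff.1 hcl _ hopen hpos
  refine ((hopen.inter isOpen_interior).measure_pos volume ⟨z, hz1, hz2⟩).trans_le
    (measure_mono fun y hy => ⟨?_, interior_subset hy.2⟩)
  exact (ne_of_gt hy.1 : _ ≠ (0 : ℝ))

theorem volume_simplex_pos (b : AffineBasis ι ℝ (Space d)) :
    0 < volume.real (convexHull ℝ (Set.range b)) := by
  obtain ⟨i⟩ := b.nonempty
  rw [← simplexIntegral_one]
  exact simplexIntegral_pos b continuous_const (fun _ _ => zero_le_one)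
    (subset_convexHull ℝ _ (Set.mem_range_self i)) zero_lt_one

theorem simplexIntegral_mul_volume (b b' : AffineBasis ι ℝ (Space d)) (g : (ι → ℝ) → ℝ) :
    simplexIntegral b' g * volume.real (convexHull ℝ (Set.range b)) =
      simplexIntegral b g * volume.real (convexHull ℝ (Set.range b')) := by
  obtain ⟨c, hc⟩ := exists_simplexIntegral_eq_mul b b'
  rw [← simplexIntegral_one, ← simplexIntegral_one, hc g, hc fun _ => 1]
  ring

theorem simplexIntegral_comp_perm (b : AffineBasis ι ℝ (Space d)) (σ : Equiv.Perm ι)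
    (g : (ι → ℝ) → ℝ) :
    simplexIntegral b (fun l => g (l ∘ σ)) = simplexIntegral b g := by
  have hrange : Set.range (b.reindex σ.symm) = Set.range b := by
    rw [b.coe_reindex, Set.range_comp, Set.range_eq_univ.2 σ.symm.symm.surjective, Set.image_univ]
  have h := simplexIntegral_mul_volume b (b.reindex σ.symm) g
  rw [hrange] at h
  rw [← mul_right_cancel₀ (volume_simplex_pos b).ne' h, simplexIntegral, simplexIntegral, hrange]
  congr 1 with x
  congr 1 with i
  simp [b.coord_reindex]

theorem simplexIntegral_sum {κ : Type*} (b : AffineBasis ι ℝ (Space d)) (s : Finset κ)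
    {g : κ → (ι → ℝ) → ℝ} (hg : ∀ k ∈ s, Continuous (g k)) :
    simplexIntegral b (fun l => ∑ k ∈ s, g k l) = ∑ k ∈ s, simplexIntegral b (g k) :=
  integral_finsetSum s fun k hk => integrableOn_simplex b ((hg k hk).comp (continuous_coords b))

theorem simplexIntegral_congr (b : AffineBasis ι ℝ (Space d)) {g g' : (ι → ℝ) → ℝ}
    (h : ∀ l : ι → ℝ, ∑ i, l i = 1 → g l = g' l) : simplexIntegral b g = simplexIntegral b g' := by
  refine integral_congr_ae (Filter.Eventually.of_forall fun x => h _ ?_)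
  simp

theorem simplexIntegral_coord (b : AffineBasis ι ℝ (Space d)) (i : ι) :
    Fintype.card ι * simplexIntegral b (fun l => l i) =
      volume.real (convexHull ℝ (Set.range b)) := by
  classical
  have hsymm : ∀ j, simplexIntegral b (fun l => l j) = simplexIntegral b (fun l => l i) := by
    intro j
    rw [← simplexIntegral_comp_perm b (Equiv.swap i j) fun l => l i]
    simp
  rw [← simplexIntegral_one, ← simplexIntegral_congr b (g := fun l => ∑ j, l j) fun l hl => hl,
    simplexIntegral_sum b _ fun j _ => continuous_apply j, Finset.sum_congr rfl fun j _ => hsymm j]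
  simp

theorem simplexIntegral_coord_mul_coord (b : AffineBasis ι ℝ (Space d)) {i j k l : ι} (hij : i ≠ j)
    (hkl : k ≠ l) :
    simplexIntegral b (fun w => w i * w j) = simplexIntegral b (fun w => w k * w l) := by
  classical
  -- A permutation that takes `k` to `i` and `l` to `j`.
  have hl : i ≠ Equiv.swap k i l := fun h => hkl <| by
    simpa using congrArg (Equiv.swap k i) h
  rw [← simplexIntegral_comp_perm b (Equiv.swap (Equiv.swap k i l) j * Equiv.swap k i)
    fun w => w k * w l]
  simp [Equiv.swap_apply_of_ne_of_ne hl hij]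

/-- The mean of the product of two distinct barycentric coordinates is a constant of the dimension
(in fact `1 / ((d + 1) * (d + 2))`); all that matters is that it is positive and less than the
value `1 / (d + 1) ^ 2` of the product at the barycenter. In dimension `0` there is no such product
and any constant will do. -/
theorem exists_simplexIntegral_coord_mul_coord (d : ℕ) :
    ∃ β : ℝ, 0 < β ∧ β * (d + 1) ^ 2 < 1 ∧
      ∀ (b : AffineBasis (Fin (d + 1)) ℝ (Space d)) (i j : Fin (d + 1)), i ≠ j →
        simplexIntegral b (fun w => w i * w j) =
          β * volume.real (convexHull ℝ (Set.range b)) := by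
  rcases Nat.eq_zero_or_pos d with rfl | hd
  · exact ⟨1 / 2, by norm_num, by norm_num, fun _ i j hij => absurd (Fin.ext (by omega)) hij⟩
  obtain ⟨b⟩ := AffineBasis.exists_affineBasis_of_finiteDimensional
    (ι := Fin (d + 1)) (k := ℝ) (P := Space d) (by simp)
  set V := volume.real (convexHull ℝ (Set.range b)) with hV
  have hVpos : 0 < V := volume_simplex_pos b
  have h01 : (0 : Fin (d + 1)) ≠ Fin.last d := by
    rw [Ne, Fin.ext_iff]
    simpa using hd.ne
  set I := simplexIntegral b (fun w => w 0 * w (Fin.last d)) with hI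
  have hIij : ∀ i j, i ≠ j → simplexIntegral b (fun w => w i * w j) = I := fun i j hij =>
    simplexIntegral_coord_mul_coord b hij h01
  have hnonneg : ∀ x ∈ convexHull ℝ (Set.range b), ∀ i, 0 ≤ b.coords x i := fun x hx i => by
    rw [b.convexHull_eq_nonneg_coord] at hx
    exact hx i
  have hIpos : 0 < I := by
    refine simplexIntegral_pos b (by fun_prop)
      (fun x hx => mul_nonneg (hnonneg x hx 0) (hnonneg x hx _))
      (interior_subset b.centroid_mem_interior_convexHull) ?_
    simp only [b.coords_apply, b.coord_apply_centroid (Finset.mem_univ _)]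
    simp
    positivity
  -- `∑ λᵢ² ≥ 1 / (d + 1)` by Cauchy-Schwarz, strictly at a vertex, so `(d + 1) * Q > V`. With the
  -- integral of `(∑ λᵢ)² = 1` this bounds `I` from above.
  set Q := simplexIntegral b (fun w => ∑ i, w i * w i) with hQ
  have hQI : Q + (d + 1) * d * I = V := by
    rw [hV, ← simplexIntegral_one, ← simplexIntegral_congr b
      (g := fun w => ∑ i, (w i * w i + ∑ j ∈ Finset.univ.erase i, w i * w j))]
    · rw [simplexIntegral_sum b _ fun i _ => by fun_prop, hQ,
        simplexIntegral_sum b _ fun i _ => by fun_prop]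
      have hi : ∀ i : Fin (d + 1), simplexIntegral b
          (fun w => w i * w i + ∑ j ∈ Finset.univ.erase i, w i * w j) =
          simplexIntegral b (fun w => w i * w i) + d * I := by
        intro i
        have h := simplexIntegral_sum b Finset.univ (g := fun j w => w i * w j)
          fun j _ => by fun_prop
        rw [← Finset.add_sum_erase _ _ (Finset.mem_univ i),
          Finset.sum_congr rfl fun j hj => hIij i j (Finset.ne_of_mem_erase hj).symm] at h
        simp only [Finset.sum_const, Finset.card_erase_of_mem (Finset.mem_univ i),
          Finset.card_univ, Fintype.card_fin, add_tsub_cancel_right, nsmul_eq_mul] at h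
        rw [← h]
        exact simplexIntegral_congr b fun w _ =>
          Finset.add_sum_erase _ (fun j => w i * w j) (Finset.mem_univ i)
      rw [Finset.sum_congr rfl fun i _ => hi i, Finset.sum_add_distrib]
      simp
      ring
    · intro w hw
      rw [Finset.sum_congr rfl fun i _ =>
        Finset.add_sum_erase _ (fun j => w i * w j) (Finset.mem_univ i)]
      simp [← Finset.mul_sum, hw]
  have hQV : 0 < (d + 1) * Q - V := by
    have hpos : 0 < simplexIntegral b (fun w => (d + 1) * ∑ i, w i * w i + (-1) * 1) := by
      refine simplexIntegral_pos b (by fun_prop) (fun x _ => ?_)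
        (subset_convexHull ℝ _ (Set.mem_range_self 0)) ?_
      · have h := sq_sum_le_card_mul_sum_sq (s := Finset.univ) (f := b.coords x)
        have h1 : ∑ i, b.coords x i = 1 := b.sum_coord_apply_eq_one x
        rw [h1] at h
        simp only [Finset.card_univ, Fintype.card_fin, sq] at h
        push_cast at h
        linarith
      · have : (0 : ℝ) < d := Nat.cast_pos.2 hd
        simp [b.coord_apply, this]
    have hadd : simplexIntegral b (fun w => (d + 1) * ∑ i, w i * w i + (-1) * 1) =
        (d + 1) * Q + (-1) * V := by
      rw [hQ, hV, ← simplexIntegral_one, ← simplexIntegral_const_mul, ← simplexIntegral_const_mul]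
      exact integral_add
        (integrableOn_simplex b ((by fun_prop : Continuous fun w : Fin (d + 1) → ℝ =>
          ((d : ℝ) + 1) * ∑ i, w i * w i).comp (continuous_coords b)))
        (integrableOn_simplex b continuous_const)
    linarith
  have hdpos : (0 : ℝ) < d := Nat.cast_pos.2 hd
  refine ⟨I / V, div_pos hIpos hVpos, ?_, fun b' i j hij => ?_⟩
  · rw [div_mul_eq_mul_div, div_lt_one hVpos]
    have : 0 < d * (V - I * (d + 1) ^ 2) := by
      have : Q = V - (d + 1) * d * I := by linarith
      rw [this] at hQV
      linarith
    linarith [(mul_pos_iff_of_pos_left hdpos).1 this]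
  · rw [div_mul_eq_mul_div, eq_div_iff hVpos.ne', hV, simplexIntegral_mul_volume b b', hIij i j hij]

theorem sum_mul_sq_sub_sq_sum {ι : Type*} [Fintype ι] {w : ι → ℝ} (hw : ∑ i, w i = 1)
    (p : ι → Space d) :
    ∑ i, w i * ‖p i‖ ^ 2 - ‖∑ i, w i • p i‖ ^ 2 =
      ∑ i, ∑ j, 1 / 2 * ‖p i - p j‖ ^ 2 * (w i * w j) := by
  have h1 : ∀ i j, 1 / 2 * ‖p i - p j‖ ^ 2 * (w i * w j) =
      1 / 2 * (w i * ‖p i‖ ^ 2) * w j + 1 / 2 * w i * (w j * ‖p j‖ ^ 2) -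
        inner ℝ (w i • p i) (w j • p j) := fun i j => by
    rw [norm_sub_sq_real, real_inner_smul_left, real_inner_smul_right]
    ring
  simp only [h1, Finset.sum_add_distrib, Finset.sum_sub_distrib, ← Finset.mul_sum, ← Finset.sum_mul,
    hw, ← inner_sum, ← sum_inner, real_inner_self_eq_norm_sq]
  ring

/-- The contribution of a simplex to `C2` is a combination, with constants that depend on `d` only,
of the integrals of `‖x‖²` and of its affine interpolation `L` at the vertices. The integral of
`L - ‖x‖²` and the value of `L - ‖x‖²` at the barycenter are both proportional to the sum of the
squared edge lengths. -/
theorem exists_norm_barycenter_sq_mul_volume (d : ℕ) :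
    ∃ K : ℝ, 1 < K ∧ ∀ F : Finset (Space d), AffineIndependent ℝ ((↑) : F → Space d) →
      F.card = d + 1 → ∀ L : Space d →ᵃ[ℝ] ℝ, (∀ p ∈ F, L p = ‖p‖ ^ 2) →
        ‖barycenter F‖ ^ 2 * simplexVolume F =
          K * (∫ x in convexHull ℝ (F : Set (Space d)), ‖x‖ ^ 2) -
            (K - 1) * ∫ x in convexHull ℝ (F : Set (Space d)), L x := by
  obtain ⟨β, hβ0, hβ1, hβ⟩ := exists_simplexIntegral_coord_mul_coord d
  have hγ : 0 < β * (d + 1) ^ 2 := by positivity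
  refine ⟨(β * (d + 1) ^ 2)⁻¹, (one_lt_inv₀ hγ).2 hβ1, fun F hF hc L hL => ?_⟩
  let e : Fin (d + 1) ≃ F := (F.equivFinOfCardEq hc).symm
  let p : Fin (d + 1) → Space d := fun i => e i
  have hind : AffineIndependent ℝ p := hF.comp_embedding e.toEmbedding
  let b : AffineBasis (Fin (d + 1)) ℝ (Space d) :=
    ⟨p, hind, hind.affineSpan_eq_top_iff_card_eq_finrank_add_one.2 (by simp)⟩
  have hb : ⇑b = p := rfl
  have hrange : Set.range b = F := by
    rw [hb]
    ext x
    exact ⟨fun ⟨i, hi⟩ => hi ▸ (e i).2, fun hx => ⟨e.symm ⟨x, hx⟩, by simp [p]⟩⟩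
  have hsum : ∀ {M : Type} [AddCommMonoid M] (f : Space d → M), ∑ i, f (p i) = ∑ x ∈ F, f x := by
    intro M _ f
    rw [← Finset.sum_coe_sort F f]
    exact e.sum_comp fun x : F => f x
  set V := volume.real (convexHull ℝ (Set.range b)) with hV
  set E := ∑ i, ∑ j, 1 / 2 * ‖p i - p j‖ ^ 2 with hE
  have hd : (d : ℝ) + 1 ≠ 0 := by positivity
  have hpt : ∀ x, ∑ i, b.coords x i • p i = x := fun x => b.linear_combination_coord_eq_self x
  have hLx : ∀ x, L x = ∑ i, b.coords x i * ‖p i‖ ^ 2 := by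
    intro x
    have h1 : ∑ i, b.coords x i = 1 := b.sum_coord_apply_eq_one x
    conv_lhs => rw [← hpt x, ← Finset.affineCombination_eq_linear_combination _ _ _ h1,
      Finset.map_affineCombination _ _ _ h1,
      Finset.affineCombination_eq_linear_combination _ _ _ h1]
    exact Finset.sum_congr rfl fun i _ => by simp [hL (p i) (e i).2]
  have hLint : ∫ x in convexHull ℝ (Set.range b), L x = (d + 1 : ℝ)⁻¹ * V * ∑ i, ‖p i‖ ^ 2 := by
    have h := simplexIntegral_sum b Finset.univ (g := fun i w => ‖p i‖ ^ 2 * w i)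
      fun i _ => by fun_prop
    simp only [simplexIntegral_const_mul] at h
    have hi : ∀ i, simplexIntegral b (fun w => w i) = (d + 1 : ℝ)⁻¹ * V := fun i => by
      rw [hV, ← simplexIntegral_coord b i, Fintype.card_fin]
      push_cast
      rw [inv_mul_cancel_left₀ hd]
    simp only [hi, ← Finset.sum_mul] at h
    rw [mul_comm, ← h, simplexIntegral]
    exact integral_congr_ae (Filter.Eventually.of_forall fun x => by simp only [hLx x, mul_comm])
  have hdiff : ∫ x in convexHull ℝ (Set.range b), (L x - ‖x‖ ^ 2) = β * V * E := by
    have h := simplexIntegral_sum b Finset.univ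
      (g := fun i w => ∑ j, 1 / 2 * ‖p i - p j‖ ^ 2 * (w i * w j)) fun i _ => by fun_prop
    have hij : ∀ i j, 1 / 2 * ‖p i - p j‖ ^ 2 * simplexIntegral b (fun w => w i * w j) =
        1 / 2 * ‖p i - p j‖ ^ 2 * (β * V) := fun i j => by
      rcases eq_or_ne i j with rfl | hne
      · simp
      · rw [hβ b i j hne]
    have hi : ∀ i, simplexIntegral b (fun w => ∑ j, 1 / 2 * ‖p i - p j‖ ^ 2 * (w i * w j)) =
        ∑ j, 1 / 2 * ‖p i - p j‖ ^ 2 * (β * V) := fun i => by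
      rw [simplexIntegral_sum b _ fun j _ => by fun_prop]
      exact Finset.sum_congr rfl fun j _ => by rw [simplexIntegral_const_mul, hij]
    simp only [hi, ← Finset.sum_mul] at h
    rw [mul_comm, hE, ← h, simplexIntegral]
    refine integral_congr_ae (Filter.Eventually.of_forall fun x => ?_)
    simp only [hLx x]
    rw [← sum_mul_sq_sub_sq_sum (w := b.coords x) (b.sum_coord_apply_eq_one x) p, hpt]
  have hbary : (d + 1 : ℝ)⁻¹ * ∑ i, ‖p i‖ ^ 2 - ‖barycenter F‖ ^ 2 =
      ((d + 1 : ℝ) ^ 2)⁻¹ * E := by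
    have h := sum_mul_sq_sub_sq_sum (w := fun _ : Fin (d + 1) => (d + 1 : ℝ)⁻¹)
      (by simp [hd]) p
    simp only [← Finset.mul_sum, ← Finset.sum_mul, ← Finset.smul_sum] at h
    rw [barycenter, ← hsum fun x => x, h, hE, ← mul_inv, ← sq, mul_comm]
    simp only [← Finset.mul_sum]
  rw [simplexVolume, ← measureReal_def, ← hrange]
  rw [integral_sub (integrableOn_simplex b (AffineMap.continuous_of_finiteDimensional L))
    (integrableOn_simplex b (by fun_prop)), hLint] at hdiff
  rw [hLint, ← hV]
  have h1 : ‖barycenter F‖ ^ 2 = (d + 1 : ℝ)⁻¹ * ∑ i, ‖p i‖ ^ 2 - ((d + 1 : ℝ) ^ 2)⁻¹ * E := by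
    linarith
  have h2 : ∫ x in convexHull ℝ (Set.range b), ‖x‖ ^ 2 =
      (d + 1 : ℝ)⁻¹ * V * ∑ i, ‖p i‖ ^ 2 - β * V * E := by linarith
  rw [h1, h2]
  field_simp
  ring

end Moments

/-! ### The full-dimensional simplices of a triangulation -/

section TopSimplices

variable {d : ℕ} {S : Finset (Space d)} {t : SimplicialComplex ℝ (Space d)}

theorem mem_topSimplices {F : Finset (Space d)} :
    F ∈ topSimplices S t ↔ (F ⊆ S ∧ F.card = d + 1) ∧ F ∈ t.faces := by
  simp only [topSimplices, Finset.mem_filter, Finset.mem_powersetCard]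

theorem IsTriangulation.subset_of_mem_faces (ht : IsTriangulation S t) {F : Finset (Space d)}
    (hF : F ∈ t.faces) : F ⊆ S := by
  intro p hp
  rw [← Finset.mem_coe, ← ht.vertices_eq, SimplicialComplex.vertices_eq]
  exact Set.mem_iUnion₂.2 ⟨F, hF, hp⟩

theorem volume_convexHull_eq_zero {F : Finset (Space d)} (hF : F.card < d + 1) :
    volume (convexHull ℝ (F : Set (Space d))) = 0 := by
  refine measure_mono_null (convexHull_subset_affineSpan _) ?_
  refine Measure.addHaar_affineSubspace _ _ fun h => ?_
  have hne := nonempty_of_span_top h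
  have hv : vectorSpan ℝ (F : Set (Space d)) = ⊤ := by
    rw [← direction_affineSpan, h, AffineSubspace.direction_top]
  have hpos := hne.card_pos
  have hle := finrank_vectorSpan_range_le ℝ ((↑) : F → Space d) (n := F.card - 1)
    (by rw [Fintype.card_coe]; omega)
  have hr : Set.range ((↑) : F → Space d) = F := by simp
  rw [hr, hv, finrank_top, finrank_euclideanSpace_fin] at hle
  omega

theorem card_le_of_affineIndependent {F : Finset (Space d)}
    (hF : AffineIndependent ℝ ((↑) : F → Space d)) : F.card ≤ d + 1 := by
  have h := hF.card_le_finrank_succ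
  have h2 := Submodule.finrank_le (vectorSpan ℝ (Set.range ((↑) : F → Space d)))
  rw [finrank_euclideanSpace_fin] at h2
  rw [Fintype.card_coe] at h
  omega

theorem span_eq_top_of_mem_topSimplices {F : Finset (Space d)} (hF : F ∈ topSimplices S t) :
    affineSpan ℝ (F : Set (Space d)) = ⊤ := by
  obtain ⟨⟨_, hc⟩, hFt⟩ := mem_topSimplices.1 hF
  have h := (t.indep hFt).affineSpan_eq_top_iff_card_eq_finrank_add_one.2 (by simpa using hc)
  simpa using h

theorem ae_notMem_convexHull_of_card_lt (S : Finset (Space d)) :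
    ∀ᵐ x, ∀ F ⊆ S, F.card < d + 1 → x ∉ convexHull ℝ (F : Set (Space d)) := by
  have h : ∀ᵐ x, ∀ F ∈ S.powerset, F.card < d + 1 → x ∉ convexHull ℝ (F : Set (Space d)) := by
    rw [Filter.eventually_all_finset]
    intro F _
    by_cases hF : F.card < d + 1
    · filter_upwards [measure_eq_zero_iff_ae_notMem.1 (volume_convexHull_eq_zero hF)] with x hx _
      exact hx
    · exact Filter.Eventually.of_forall fun _ h => absurd h hF
  simpa only [Finset.mem_powerset] using h

/-- Up to a null set, the full-dimensional simplices cover the convex hull: the other simplices have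
measure zero. -/
theorem IsTriangulation.ae_exists_mem (ht : IsTriangulation S t) :
    ∀ᵐ x, x ∈ convexHull ℝ (S : Set (Space d)) →
      ∃ F ∈ topSimplices S t, x ∈ convexHull ℝ (F : Set (Space d)) := by
  filter_upwards [ae_notMem_convexHull_of_card_lt S] with x hx hxS
  rw [← ht.space_eq, SimplicialComplex.mem_space_iff] at hxS
  obtain ⟨F, hF, hxF⟩ := hxS
  have hFS := ht.subset_of_mem_faces hF
  refine ⟨F, mem_topSimplices.2 ⟨⟨hFS, ?_⟩, hF⟩, hxF⟩
  exact le_antisymm (card_le_of_affineIndependent (t.indep hF))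
    (not_lt.1 fun hlt => hx F hFS hlt hxF)

theorem volume_inter_eq_zero {F G : Finset (Space d)} (hF : F ∈ topSimplices S t)
    (hG : G ∈ topSimplices S t) (hFG : F ≠ G) :
    volume (convexHull ℝ (F : Set (Space d)) ∩ convexHull ℝ (G : Set (Space d))) = 0 := by
  classical
  obtain ⟨⟨_, hFc⟩, hFt⟩ := mem_topSimplices.1 hF
  obtain ⟨⟨_, hGc⟩, hGt⟩ := mem_topSimplices.1 hG
  refine measure_mono_null (t.inter_subset_convexHull hFt hGt) ?_
  rw [← Finset.coe_inter]
  refine volume_convexHull_eq_zero (not_le.1 fun hle => hFG ?_)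
  have h1 := Finset.eq_of_subset_of_card_le (Finset.inter_subset_left (s₁ := F) (s₂ := G))
    (by omega)
  have h2 := Finset.eq_of_subset_of_card_le (Finset.inter_subset_right (s₁ := F) (s₂ := G))
    (by omega)
  exact h1.symm.trans h2

theorem ae_unique_topSimplex :
    ∀ᵐ x, ∀ F ∈ topSimplices S t, ∀ G ∈ topSimplices S t,
      x ∈ convexHull ℝ (F : Set (Space d)) → x ∈ convexHull ℝ (G : Set (Space d)) → F = G := by
  rw [Filter.eventually_all_finset]
  intro F hF
  rw [Filter.eventually_all_finset]
  intro G hG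
  by_cases hFG : F = G
  · exact Filter.Eventually.of_forall fun _ _ _ => hFG
  · filter_upwards [measure_eq_zero_iff_ae_notMem.1 (volume_inter_eq_zero hF hG hFG)] with x hx
    exact fun h1 h2 => absurd ⟨h1, h2⟩ hx

theorem IsTriangulation.convexHull_ae_eq (ht : IsTriangulation S t) :
    (⋃ F ∈ topSimplices S t, convexHull ℝ (F : Set (Space d))) =ᵐ[volume]
      convexHull ℝ (S : Set (Space d)) := by
  filter_upwards [ht.ae_exists_mem] with x hx
  refine propext ⟨fun h => ?_, fun h => ?_⟩
  · obtain ⟨F, hF, hxF⟩ := Set.mem_iUnion₂.1 h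
    exact convexHull_mono (Finset.coe_subset.2 (mem_topSimplices.1 hF).1.1) hxF
  · obtain ⟨F, hF, hxF⟩ := hx h
    exact Set.mem_iUnion₂.2 ⟨F, hF, hxF⟩

theorem IsTriangulation.sum_setIntegral (ht : IsTriangulation S t) {g : Space d → ℝ}
    (hg : Continuous g) :
    ∑ F ∈ topSimplices S t, ∫ x in convexHull ℝ (F : Set (Space d)), g x =
      ∫ x in convexHull ℝ (S : Set (Space d)), g x := by
  have hm : ∀ F : Finset (Space d), MeasurableSet (convexHull ℝ (F : Set (Space d))) := fun F =>
    (isCompact_convexHull_finset F).measurableSet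
  rw [← setIntegral_congr_set ht.convexHull_ae_eq]
  have hi : ∀ F ∈ topSimplices S t, IntegrableOn g (convexHull ℝ (F : Set (Space d))) :=
    fun F _ => hg.continuousOn.integrableOn_compact (isCompact_convexHull_finset F)
  have h := integral_iUnion_ae (μ := volume) (f := g)
    (s := fun F : topSimplices S t => convexHull ℝ ((F : Finset (Space d)) : Set (Space d)))
    (fun F => (hm F).nullMeasurableSet)
    (fun F G hFG => volume_inter_eq_zero F.2 G.2 fun h => hFG (Subtype.ext h))
    (by
      rw [integrableOn_finite_iUnion]
      exact fun F => hi F F.2)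
  rw [tsum_fintype, Finset.sum_coe_sort (topSimplices S t)
    (fun F => ∫ x in convexHull ℝ (F : Set (Space d)), g x)] at h
  rw [← h, Set.iUnion_subtype]

/-- A point of the convex hull lies in a full-dimensional simplex, as these simplices form a closed
set that contains almost all points of the hull. -/
theorem IsTriangulation.exists_mem_topSimplex (ht : IsTriangulation S t)
    (hspan : affineSpan ℝ (S : Set (Space d)) = ⊤) {x : Space d}
    (hx : x ∈ convexHull ℝ (S : Set (Space d))) :
    ∃ F ∈ topSimplices S t, x ∈ convexHull ℝ (F : Set (Space d)) := by
  set U := ⋃ F ∈ topSimplices S t, convexHull ℝ (F : Set (Space d)) with hU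
  have hclosed : IsClosed U :=
    isClosed_biUnion_finset fun F _ => (isCompact_convexHull_finset F).isClosed
  have hsub : interior (convexHull ℝ (S : Set (Space d))) ⊆ U := by
    by_contra h
    obtain ⟨z, hz, hzU⟩ := Set.not_subset.1 h
    refine ((isOpen_interior.inter hclosed.isOpen_compl).measure_pos volume ⟨z, hz, hzU⟩).ne' ?_
    rw [measure_eq_zero_iff_ae_notMem]
    filter_upwards [ht.ae_exists_mem] with y hy hy'
    obtain ⟨F, hF, hyF⟩ := hy (interior_subset hy'.1)
    exact hy'.2 (Set.mem_iUnion₂.2 ⟨F, hF, hyF⟩)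
  have := closure_minimal hsub hclosed
  rw [closure_interior_convexHull hspan] at this
  obtain ⟨F, hF, hxF⟩ := Set.mem_iUnion₂.1 (this hx)
  exact ⟨F, hF, hxF⟩

/-- Every face is contained in a full-dimensional one, namely in one that contains its
barycenter. -/
theorem IsTriangulation.exists_subset_topSimplex (ht : IsTriangulation S t)
    (hspan : affineSpan ℝ (S : Set (Space d)) = ⊤) {F : Finset (Space d)} (hF : F ∈ t.faces) :
    ∃ G ∈ topSimplices S t, F ⊆ G := by
  classical
  have hne := SimplicialComplex.nonempty_of_mem_faces hF
  have hcF : F.centroid ℝ id ∈ convexHull ℝ (F : Set (Space d)) :=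
    F.centroid_mem_convexHull hne
  have hcS := convexHull_mono (Finset.coe_subset.2 (ht.subset_of_mem_faces hF)) hcF
  obtain ⟨G, hG, hcG⟩ := ht.exists_mem_topSimplex hspan hcS
  refine ⟨G, hG, ?_⟩
  have hc := t.inter_subset_convexHull hF (mem_topSimplices.1 hG).2 ⟨hcF, hcG⟩
  rw [← Finset.coe_inter] at hc
  obtain ⟨w, -, hw1, hwc⟩ := Finset.mem_convexHull'.1 hc
  -- Affine independence identifies these weights with those of the barycenter, which are nonzero.
  let v : Space d → ℝ := fun p => (if p ∈ F ∩ G then w p else 0) - (F.card : ℝ)⁻¹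
  have hcard : (F.card : ℝ) ≠ 0 := Nat.cast_ne_zero.2 hne.card_ne_zero
  have hFG : F ∩ (F ∩ G) = F ∩ G := Finset.inter_eq_right.2 Finset.inter_subset_left
  have hv0 : ∑ p ∈ F, v p = 0 := by
    simp only [v, Finset.sum_sub_distrib, Finset.sum_ite_mem, hFG, hw1]
    simp [hcard]
  have hcent : F.centroid ℝ id = ∑ p ∈ F, (F.card : ℝ)⁻¹ • p := by
    rw [Finset.centroid_def, Finset.affineCombination_eq_linear_combination]
    · simp [Finset.centroidWeights]
    · exact F.sum_centroidWeights_eq_one_of_nonempty ℝ hne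
  have hv1 : ∑ p ∈ F, v p • p = 0 := by
    simp only [v, sub_smul, Finset.sum_sub_distrib, ite_smul, zero_smul, Finset.sum_ite_mem, hFG,
      hwc, hcent, sub_self]
  have hv := (t.indep hF).eq_zero_of_sum_eq_zero_subtype hv0 hv1
  intro p hp
  by_contra hpG
  have := hv p hp
  simp [v, hpG, hcard] at this

theorem IsTriangulation.mem_faces_iff (ht : IsTriangulation S t)
    (hspan : affineSpan ℝ (S : Set (Space d)) = ⊤) {F : Finset (Space d)} :
    F ∈ t.faces ↔ F.Nonempty ∧ ∃ G ∈ topSimplices S t, F ⊆ G := by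
  constructor
  · exact fun hF => ⟨SimplicialComplex.nonempty_of_mem_faces hF,
      ht.exists_subset_topSimplex hspan hF⟩
  · rintro ⟨hne, G, hG, hFG⟩
    exact t.down_closed (mem_topSimplices.1 hG).2 hFG hne

/-- A triangulation whose full-dimensional simplices are among those of another one is equal to it,
since there is no room left for a further simplex. -/
theorem IsTriangulation.eq_of_topSimplices_subset {t' : SimplicialComplex ℝ (Space d)}
    (ht : IsTriangulation S t) (ht' : IsTriangulation S t')
    (hspan : affineSpan ℝ (S : Set (Space d)) = ⊤) (h : topSimplices S t ⊆ topSimplices S t') :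
    t = t' := by
  have htop : topSimplices S t = topSimplices S t' := by
    refine h.antisymm fun G hG => ?_
    have hpos : 0 < volume (interior (convexHull ℝ (G : Set (Space d)))) :=
      isOpen_interior.measure_pos volume
        (interior_convexHull_nonempty (span_eq_top_of_mem_topSimplices hG))
    by_contra hGt
    refine hpos.ne' (measure_eq_zero_iff_ae_notMem.2 ?_)
    filter_upwards [ht.ae_exists_mem, ae_unique_topSimplex (S := S) (t := t')] with x hx hx' hxG
    have hxG' := interior_subset hxG
    obtain ⟨F, hF, hxF⟩ := hx
      (convexHull_mono (Finset.coe_subset.2 (mem_topSimplices.1 hG).1.1) hxG')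
    exact hGt (hx' F (h hF) G hG hxF hxG' ▸ hF)
  refine SimplicialComplex.ext (Set.ext fun F => ?_)
  rw [ht.mem_faces_iff hspan, ht'.mem_faces_iff hspan, htop]

end TopSimplices

/-! ### Piecewise affine interpolation of the paraboloid -/

section Interpolant

variable {d : ℕ} {S : Finset (Space d)} {t : SimplicialComplex ℝ (Space d)}

theorem exists_affineMap_eq_norm_sq {F : Finset (Space d)}
    (hF : AffineIndependent ℝ ((↑) : F → Space d))
    (hspan : affineSpan ℝ (F : Set (Space d)) = ⊤) :
    ∃ L : Space d →ᵃ[ℝ] ℝ, ∀ p ∈ F, L p = ‖p‖ ^ 2 := by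
  classical
  let b : AffineBasis F ℝ (Space d) := ⟨(↑), hF, by simpa using hspan⟩
  refine ⟨(Fintype.linearCombination ℝ fun i : F => ‖b i‖ ^ 2).toAffineMap.comp b.coords,
    fun p hp => ?_⟩
  have h : ∀ i, b.coord i p = if i = ⟨p, hp⟩ then 1 else 0 := fun i => b.coord_apply i ⟨p, hp⟩
  have hb : b ⟨p, hp⟩ = p := rfl
  simp [Fintype.linearCombination_apply, h, hb]

open Classical in
/-- The affine function that agrees with `‖x‖²` at the points of `F`; zero if there is none. -/
def paraboloidChord (F : Finset (Space d)) : Space d →ᵃ[ℝ] ℝ :=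
  if h : ∃ L : Space d →ᵃ[ℝ] ℝ, ∀ p ∈ F, L p = ‖p‖ ^ 2 then h.choose else 0

theorem paraboloidChord_apply {F : Finset (Space d)} (hF : F ∈ topSimplices S t) {p : Space d}
    (hp : p ∈ F) : paraboloidChord F p = ‖p‖ ^ 2 := by
  have h := exists_affineMap_eq_norm_sq (t.indep (mem_topSimplices.1 hF).2)
    (span_eq_top_of_mem_topSimplices hF)
  rw [paraboloidChord, dif_pos h]
  exact h.choose_spec p hp

theorem paraboloidChord_sum_smul {F : Finset (Space d)} (hF : F ∈ topSimplices S t)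
    {w : Space d → ℝ} (hw1 : ∑ p ∈ F, w p = 1) :
    paraboloidChord F (∑ p ∈ F, w p • p) = ∑ p ∈ F, w p * ‖p‖ ^ 2 := by
  have h := F.map_affineCombination id w hw1 (paraboloidChord F)
  rw [Finset.affineCombination_eq_linear_combination _ _ _ hw1,
    Finset.affineCombination_eq_linear_combination _ _ _ hw1] at h
  simp only [id_eq, Function.comp_id, smul_eq_mul] at h
  rw [h]
  exact Finset.sum_congr rfl fun p hp => by rw [paraboloidChord_apply hF hp]

open Classical in
/-- The piecewise affine function that interpolates `‖x‖²` at the vertices of the triangulation. Its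
values on the boundaries of the simplices are sums over the simplices that meet there; they play no
role. -/
def interpolant (S : Finset (Space d)) (t : SimplicialComplex ℝ (Space d)) (x : Space d) : ℝ :=
  ∑ F ∈ topSimplices S t,
    (convexHull ℝ (F : Set (Space d))).indicator (fun x => paraboloidChord F x) x

theorem ae_interpolant_eq (S : Finset (Space d)) (t : SimplicialComplex ℝ (Space d)) :
    ∀ᵐ x, ∀ F ∈ topSimplices S t, x ∈ convexHull ℝ (F : Set (Space d)) →
      interpolant S t x = paraboloidChord F x := by
  filter_upwards [ae_unique_topSimplex (S := S) (t := t)] with x hx F hF hxF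
  rw [interpolant, Finset.sum_eq_single_of_mem F hF, Set.indicator_of_mem hxF]
  exact fun G hG hGF => Set.indicator_of_notMem (fun hxG => hGF (hx G hG F hF hxG hxF)) _

theorem integrableOn_paraboloidChord (F : Finset (Space d)) :
    IntegrableOn (fun x => paraboloidChord F x) (convexHull ℝ (F : Set (Space d))) :=
  (AffineMap.continuous_of_finiteDimensional _).continuousOn.integrableOn_compact
    (isCompact_convexHull_finset F)

theorem integrable_interpolant (S : Finset (Space d)) (t : SimplicialComplex ℝ (Space d)) :
    Integrable (interpolant S t) :=
  integrable_finsetSum _ fun F _ => (integrableOn_paraboloidChord F).integrable_indicator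
    (isCompact_convexHull_finset F).measurableSet

theorem setIntegral_interpolant (S : Finset (Space d)) (t : SimplicialComplex ℝ (Space d)) :
    ∫ x in convexHull ℝ (S : Set (Space d)), interpolant S t x =
      ∑ F ∈ topSimplices S t, ∫ x in convexHull ℝ (F : Set (Space d)), paraboloidChord F x := by
  simp only [interpolant]
  rw [integral_finsetSum _ fun F _ => ((integrableOn_paraboloidChord F).integrable_indicator
    (isCompact_convexHull_finset F).measurableSet).integrableOn]
  refine Finset.sum_congr rfl fun F hF => ?_
  rw [setIntegral_indicator (isCompact_convexHull_finset F).measurableSet,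
    Set.inter_eq_self_of_subset_right
      (convexHull_mono (Finset.coe_subset.2 (mem_topSimplices.1 hF).1.1))]

/-- Apart from a term that does not depend on the triangulation, `C2` is a negative multiple of the
volume below the interpolant. -/
theorem exists_C2_eq (S : Finset (Space d)) :
    ∃ A κ : ℝ, 0 < κ ∧ ∀ t : SimplicialComplex ℝ (Space d), IsTriangulation S t →
      C2 S t = A - κ * ∫ x in convexHull ℝ (S : Set (Space d)), interpolant S t x := by
  obtain ⟨K, hK, h⟩ := exists_norm_barycenter_sq_mul_volume d
  refine ⟨K * ∫ x in convexHull ℝ (S : Set (Space d)), ‖x‖ ^ 2, K - 1, sub_pos.2 hK,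
    fun t ht => ?_⟩
  rw [C2, setIntegral_interpolant, ← ht.sum_setIntegral (g := fun x => ‖x‖ ^ 2) (by fun_prop),
    Finset.mul_sum, Finset.mul_sum, ← Finset.sum_sub_distrib]
  refine Finset.sum_congr rfl fun F hF => ?_
  obtain ⟨⟨_, hc⟩, hFt⟩ := mem_topSimplices.1 hF
  exact h F (t.indep hFt) hc _ fun p hp => paraboloidChord_apply hF hp

/-- Where a simplex `F` of any triangulation overlaps a Delaunay simplex `G`, the chord over `G` is
the lower one, and strictly lower unless `F = G` at points off the lower-dimensional simplices with
vertices in `S`. -/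
theorem paraboloidChord_le {D : SimplicialComplex ℝ (Space d)} (hD : IsDelaunay S D)
    (hgen : IsGeneric S) {F G : Finset (Space d)} (hF : F ∈ topSimplices S t)
    (hG : G ∈ topSimplices S D) {x : Space d} (hxF : x ∈ convexHull ℝ (F : Set (Space d)))
    (hxG : x ∈ convexHull ℝ (G : Set (Space d)))
    (hx : ∀ F' ⊆ S, F'.card < d + 1 → x ∉ convexHull ℝ (F' : Set (Space d))) :
    paraboloidChord G x ≤ paraboloidChord F x ∧
      (paraboloidChord G x = paraboloidChord F x → F = G) := by
  classical
  obtain ⟨⟨hFS, hFc⟩, _⟩ := mem_topSimplices.1 hF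
  obtain ⟨⟨_, hGc⟩, hGD⟩ := mem_topSimplices.1 hG
  obtain ⟨_, c, hGn⟩ := (isDelaunay_iff.1 hD G).1 hGD
  obtain ⟨w, hw0, hw1, hwx⟩ := Finset.mem_convexHull'.1 hxF
  obtain ⟨v, _, hv1, hvx⟩ := Finset.mem_convexHull'.1 hxG
  have hFx : paraboloidChord F x = ∑ p ∈ F, w p * ‖p‖ ^ 2 := by
    rw [← paraboloidChord_sum_smul hF hw1, hwx]
  have hGx : paraboloidChord G x = ∑ p ∈ G, v p * ‖p‖ ^ 2 := by
    rw [← paraboloidChord_sum_smul hG hv1, hvx]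
  have h := sum_mul_norm_sq_le hGn hv1 hvx hFS hw0 hw1 hwx
  rw [hFx, hGx]
  refine ⟨h.1, fun heq => ?_⟩
  have hGn' : G = nearest S c :=
    Finset.eq_of_subset_of_card_le hGn (hGc ▸ card_nearest_le hgen c)
  refine Finset.eq_of_subset_of_card_le (fun p hp => hGn' ▸ h.2 heq p hp fun hwp => ?_)
    (by rw [hFc, hGc])
  -- If a weight vanishes, then `x` lies on a facet of `F`.
  refine hx (F.erase p) ((Finset.erase_subset p F).trans hFS)
    (hFc ▸ Finset.card_erase_lt_of_mem hp) (Finset.mem_convexHull'.2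
      ⟨w, fun q hq => hw0 q (Finset.mem_of_mem_erase hq), ?_, ?_⟩)
  · rw [Finset.sum_erase _ hwp, hw1]
  · rw [Finset.sum_erase _ (by rw [hwp, zero_smul]), hwx]

theorem C2_le_of_isDelaunay {D : SimplicialComplex ℝ (Space d)}
    (hspan : affineSpan ℝ (S : Set (Space d)) = ⊤) (hgen : IsGeneric S)
    (hDt : IsTriangulation S D) (hD : IsDelaunay S D) (ht : IsTriangulation S t) :
    C2 S t ≤ C2 S D ∧ (C2 S t = C2 S D → t = D) := by
  obtain ⟨A, κ, hκ, hC⟩ := exists_C2_eq S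
  rw [hC t ht, hC D hDt]
  have hle : ∀ᵐ x ∂volume.restrict (convexHull ℝ (S : Set (Space d))),
      interpolant S D x ≤ interpolant S t x := by
    rw [ae_restrict_iff' (isCompact_convexHull_finset S).measurableSet]
    filter_upwards [ae_interpolant_eq S t, ae_interpolant_eq S D, ht.ae_exists_mem,
      hDt.ae_exists_mem, ae_notMem_convexHull_of_card_lt S] with x h1 h2 h3 h4 h5 hxS
    obtain ⟨F, hF, hxF⟩ := h3 hxS
    obtain ⟨G, hG, hxG⟩ := h4 hxS
    rw [h1 F hF hxF, h2 G hG hxG]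
    exact (paraboloidChord_le hD hgen hF hG hxF hxG h5).1
  have hiD := (integrable_interpolant S D).integrableOn (s := convexHull ℝ (S : Set (Space d)))
  have hit := (integrable_interpolant S t).integrableOn (s := convexHull ℝ (S : Set (Space d)))
  refine ⟨sub_le_sub_left (mul_le_mul_of_nonneg_left (integral_mono_ae hiD hit hle) hκ.le) A,
    fun heq => ?_⟩
  have hint := mul_left_cancel₀ hκ.ne' (sub_right_injective heq)
  have hae := (integral_eq_iff_of_ae_le hiD hit hle).1 hint.symm
  rw [Filter.EventuallyEq, ae_restrict_iff' (isCompact_convexHull_finset S).measurableSet] at hae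
  refine ht.eq_of_topSimplices_subset hDt hspan fun F hF => ?_
  have hpos : volume (convexHull ℝ (F : Set (Space d))) ≠ 0 :=
    ((isOpen_interior.measure_pos volume (interior_convexHull_nonempty
      (span_eq_top_of_mem_topSimplices hF))).trans_le (measure_mono interior_subset)).ne'
  obtain ⟨x, hxF, h0, h1, h2, h4, h5⟩ := ((frequently_ae_mem_iff.2 hpos).and_eventually
    (hae.and ((ae_interpolant_eq S t).and ((ae_interpolant_eq S D).and
      (hDt.ae_exists_mem.and (ae_notMem_convexHull_of_card_lt S)))))).exists
  have hxS := convexHull_mono (Finset.coe_subset.2 (mem_topSimplices.1 hF).1.1) hxF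
  obtain ⟨G, hG, hxG⟩ := h4 hxS
  have := h0 hxS
  rw [h1 F hF hxF, h2 G hG hxG] at this
  exact (paraboloidChord_le hD hgen hF hG hxF hxG h5).2 this ▸ hG

end Interpolant

end PointSet

end

theorem theorem1 (d : ℕ) (S : Finset (PointSet.Space d))
    (hspan : affineSpan ℝ (S : Set (PointSet.Space d)) = ⊤)
    (hgen : PointSet.IsGeneric S) :
    (∃ t : Geometry.SimplicialComplex ℝ (PointSet.Space d),
      PointSet.IsTriangulation S t ∧ PointSet.IsDelaunay S t) ∧
    ∀ t : Geometry.SimplicialComplex ℝ (PointSet.Space d), PointSet.IsTriangulation S t →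
      ((∀ t' : Geometry.SimplicialComplex ℝ (PointSet.Space d), PointSet.IsTriangulation S t' →
          PointSet.C2 S t' ≤ PointSet.C2 S t) ↔
        PointSet.IsDelaunay S t) := by
  have hDt := PointSet.isTriangulation_delaunayComplex hspan hgen
  have hD := PointSet.isDelaunay_delaunayComplex hspan hgen
  refine ⟨⟨_, hDt, hD⟩, fun t ht => ⟨fun hmax => ?_, fun htD t' ht' =>
    (PointSet.C2_le_of_isDelaunay hspan hgen ht htD ht').1⟩⟩
  obtain ⟨hle, heq⟩ := PointSet.C2_le_of_isDelaunay hspan hgen hDt hD ht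
  rw [heq (hle.antisymm (hmax _ hDt))]
  exact hD
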